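/- Let $p$ be a prime number and let $G$ be a $p$-adic analytic group, i.e. a topological group which carries the structure of a finite-dimensional analytic manifold over $\mathbb{Q}_p$ such that multiplication and inversion are analytic. Let $k$ be a field of positive characteristic (not necessarily equal to $p$). Let $\mathrm{Rep}_k(G)$ be the category of all representations of the abstract group $G$ on $k$-vector spaces, and let $\mathrm{Rep}_k^{\mathrm{sm}}(G)$ be its full subcategory of smooth representations, i.e. of those $V$ for which the action map $G\times V\to V$ is continuous when $V$ carries the discrete topology. For $V\in\mathrm{Rep}_k(G)$ put $V^{\mathrm{sm}}=\bigcup_K V^K$, where $K$ runs through the compact open subgroups of $G$ and $V^K$ is the subspace of $K$-fixed vectors. This defines a left exact functor $$\mathrm{sm}\colon \mathrm{Rep}_k(G)\longrightarrow \mathrm{Rep}_k^{\mathrm{sm}}(G),\qquad V\longmapsto V^{\mathrm{sm}}.$$ Then for every smooth representation $V\in\mathrm{Rep}_k^{\mathrm{sm}}(G)$ the first right derived functor of $\mathrm{sm}$ vanishes on $V$: $$\mathbf{R}^1\mathrm{sm}(V)=\{0\}.$$ -/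

import Mathlib

open CategoryTheory CategoryTheory.Limits
open scoped Manifold ContDiff

universe u v w

/-- A `p`-adic analytic group: a topological space with a group structure that carries the structure
of a finite-dimensional analytic manifold over `ℚ_p` for which multiplication and inversion
are analytic maps. (The dimension is constant, by homogeneity.) -/
def IsPadicAnalyticGroup (p : ℕ) [Fact p.Prime] (G : Type v) [Group G] [TopologicalSpace G] :
    Prop :=
  ∃ (d : ℕ) (_ : ChartedSpace (Fin d → ℚ_[p]) G),
    LieGroup 𝓘(ℚ_[p], Fin d → ℚ_[p]) ω G

namespace SmoothRep

instance enoughInjectives_rep (k : Type u) [Field k] (G : Type v) [Group G] :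
    EnoughInjectives (Rep.{max u v w} k G) := by
  have : EnoughInjectives (ModuleCat.{max u v w} (MonoidAlgebra k G)) := inferInstance
  exact EnoughInjectives.of_equivalence (Rep.toModuleMonoidAlgebra (k := k) (G := G))

variable {k : Type u} [Field k] {G : Type v} [Group G]

/-- The subspace `V ^ K` of vectors fixed by the subgroup `K`. -/
noncomputable def fixedBy (V : Rep.{w} k G) (K : Subgroup G) : Submodule k V :=
  Representation.invariants (V.ρ.comp K.subtype)

lemma mem_fixedBy {V : Rep.{w} k G} {K : Subgroup G} {x : V} :
    x ∈ fixedBy V K ↔ ∀ g ∈ K, V.ρ g x = x := by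
  simp [fixedBy, Representation.mem_invariants]

variable (k G) [TopologicalSpace G]

/-- A representation `V` is smooth if the action map `G × V → V` is continuous for the discrete
topology on `V`. -/
def IsSmooth : ObjectProperty (Rep.{w} k G) := fun V =>
  letI : TopologicalSpace V := ⊥
  Continuous fun x : G × V => V.ρ x.1 x.2

/-- The category of smooth representations, a full subcategory of `Rep k G`. -/
abbrev SmRep : Type (max u v (w + 1)) := (IsSmooth.{u, v, w} k G).FullSubcategory

variable {k G}

/-- The smooth part of `V`: the union of the subspaces `V ^ K`, where `K` runs through the compact
open subgroups of `G`. It is written as a sum of subspaces. The sum is a union as soon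
as `G` has some compact open subgroup, see `mem_smoothPart_iff`. -/
noncomputable def smoothPart (V : Rep.{w} k G) : Submodule k V :=
  ⨆ K : {K : Subgroup G // IsCompact (K : Set G) ∧ IsOpen (K : Set G)}, fixedBy V K.1

lemma mem_smoothPart_iff [IsTopologicalGroup G]
    (hG : ∃ K : Subgroup G, IsCompact (K : Set G) ∧ IsOpen (K : Set G))
    {V : Rep.{w} k G} {x : V} :
    x ∈ smoothPart V ↔
      ∃ K : Subgroup G, IsCompact (K : Set G) ∧ IsOpen (K : Set G) ∧ ∀ g ∈ K, V.ρ g x = x := by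
  have : Nonempty {K : Subgroup G // IsCompact (K : Set G) ∧ IsOpen (K : Set G)} :=
    ⟨⟨hG.choose, hG.choose_spec⟩⟩
  rw [smoothPart, Submodule.mem_iSup_of_directed]
  · simp only [mem_fixedBy, Subtype.exists, exists_prop, and_assoc]
  · intro K L
    refine ⟨⟨K.1 ⊓ L.1, ?_, ?_⟩, fun x hx => ?_, fun x hx => ?_⟩
    · rw [Subgroup.coe_inf]
      exact K.2.1.inter_right (L.1.isClosed_of_isOpen L.2.2)
    · rw [Subgroup.coe_inf]
      exact K.2.2.inter L.2.2
    · exact mem_fixedBy.2 fun g hg => mem_fixedBy.1 hx g hg.1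
    · exact mem_fixedBy.2 fun g hg => mem_fixedBy.1 hx g hg.2

lemma exists_isOpen_of_mem_smoothPart (V : Rep.{w} k G) {x : V} (hx : x ∈ smoothPart V) :
    ∃ K : Subgroup G, IsOpen (K : Set G) ∧ ∀ g ∈ K, V.ρ g x = x := by
  refine Submodule.iSup_induction _ (motive := fun x : V =>
    ∃ K : Subgroup G, IsOpen (K : Set G) ∧ ∀ g ∈ K, V.ρ g x = x) hx ?_ ?_ ?_
  · exact fun K x hx => ⟨K.1, K.2.2, mem_fixedBy.1 hx⟩
  · exact ⟨⊤, by simp, by simp⟩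
  · rintro x y ⟨K, hK, hx⟩ ⟨L, hL, hy⟩
    refine ⟨K ⊓ L, ?_, fun g hg => by rw [map_add, hx g hg.1, hy g hg.2]⟩
    rw [Subgroup.coe_inf]
    exact hK.inter hL

lemma map_mem_smoothPart {V W : Rep.{w} k G} (f : V ⟶ W) {x : V} (hx : x ∈ smoothPart V) :
    f.hom x ∈ smoothPart W := by
  have : smoothPart V ≤ (smoothPart W).comap f.hom.toLinearMap := by
    refine iSup_le fun K x hx => ?_
    refine (le_iSup (fun K : {K : Subgroup G // IsCompact (K : Set G) ∧ IsOpen (K : Set G)} =>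
      fixedBy W K.1) K) (mem_fixedBy.2 fun g hg => ?_)
    exact (Rep.hom_comm_apply f g x).symm.trans (congrArg f.hom (mem_fixedBy.1 hx g hg))
  exact this hx

variable [IsTopologicalGroup G]

/-- A representation is smooth if and only if every vector is fixed by some open subgroup. -/
lemma isSmooth_iff (V : Rep.{w} k G) :
    IsSmooth k G V ↔
      ∀ x : V, ∃ K : Subgroup G, IsOpen (K : Set G) ∧ ∀ g ∈ K, V.ρ g x = x := by
  let _ : TopologicalSpace V := ⊥
  have : DiscreteTopology V := ⟨rfl⟩
  change (Continuous fun x : G × V => V.ρ x.1 x.2) ↔ _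
  constructor
  · intro h x
    let K : Subgroup G :=
      { carrier := {g | V.ρ g x = x}
        mul_mem' := fun {a b} ha hb => by
          simp only [Set.mem_ofPred_eq] at ha hb ⊢
          rw [map_mul, Module.End.mul_apply, hb, ha]
        one_mem' := by simp
        inv_mem' := fun {a} ha => by
          simp only [Set.mem_ofPred_eq] at ha ⊢
          conv_lhs => rw [← ha]
          simp }
    refine ⟨K, ?_, fun g hg => hg⟩
    exact (isOpen_discrete {x}).preimage (h.comp (Continuous.prodMk_left x))
  · intro h
    refine continuous_iff_continuousAt.2 fun ⟨g, x⟩ => ?_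
    obtain ⟨K, hK, hfix⟩ := h x
    refine (continuousAt_const (y := V.ρ g x)).congr ?_
    have hU : IsOpen ({a : G | g⁻¹ * a ∈ K} ×ˢ ({x} : Set V)) :=
      (hK.preimage (continuous_const_mul g⁻¹)).prod (isOpen_discrete _)
    filter_upwards [hU.mem_nhds (by simp [K.one_mem])]
    rintro ⟨a, y⟩ ⟨ha, hy⟩
    obtain rfl : y = x := hy
    have := hfix _ ha
    conv_lhs => rw [← this]
    simp [← Module.End.mul_apply, ← map_mul]

lemma apply_mem_smoothPart (V : Rep.{w} k G) (g : G) :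
    smoothPart V ≤ (smoothPart V).comap (V.ρ g) := by
  refine iSup_le fun K x hx => ?_
  have hcoe : ((K.1.map (MulAut.conj g).toMonoidHom : Subgroup G) : Set G) =
      ((Homeomorph.mulLeft g).trans (Homeomorph.mulRight g⁻¹)) '' (K.1 : Set G) := by
    ext; simp
  have hc : IsCompact ((K.1.map (MulAut.conj g).toMonoidHom : Subgroup G) : Set G) := by
    rw [hcoe]; exact K.2.1.image (Homeomorph.continuous _)
  have ho : IsOpen ((K.1.map (MulAut.conj g).toMonoidHom : Subgroup G) : Set G) := by
    rw [hcoe]; exact (Homeomorph.isOpenMap _) _ K.2.2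
  refine (le_iSup (fun K : {K : Subgroup G // IsCompact (K : Set G) ∧ IsOpen (K : Set G)} =>
    fixedBy V K.1) ⟨_, hc, ho⟩) ?_
  refine mem_fixedBy.2 ?_
  rintro _ ⟨a, ha, rfl⟩
  have := mem_fixedBy.1 hx a ha
  conv_rhs => rw [← this]
  simp [← Module.End.mul_apply, ← map_mul]

/-- The smooth part as a subrepresentation. -/
noncomputable abbrev smoothPartRep (V : Rep.{w} k G) : Rep.{w} k G :=
  V.subrepresentation (smoothPart V) (apply_mem_smoothPart V)

lemma isSmooth_smoothPartRep (V : Rep.{w} k G) : IsSmooth k G (smoothPartRep V) := by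
  rw [isSmooth_iff]
  rintro ⟨x, hx⟩
  obtain ⟨K, hK, h⟩ := exists_isOpen_of_mem_smoothPart V hx
  exact ⟨K, hK, fun g hg => Subtype.ext (h g hg)⟩

/-- A morphism of representations restricts to the smooth parts. -/
noncomputable def smoothPartMap {V W : Rep.{w} k G} (f : V ⟶ W) : smoothPartRep V ⟶ smoothPartRep W :=
  Rep.ofHom
    { toLinearMap := f.hom.toLinearMap.restrict fun _ hx => map_mem_smoothPart f hx
      isIntertwining' := fun g => by
        ext x
        exact Rep.hom_comm_apply f g x.1 }

variable (k G)

/-- The smooth part functor `Rep k G ⥤ SmRep k G`. -/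
noncomputable def smoothFunctor : Rep.{w} k G ⥤ SmRep.{u, v, w} k G where
  obj V := ⟨smoothPartRep V, isSmooth_smoothPartRep V⟩
  map f := ObjectProperty.homMk (smoothPartMap f)
  map_id V := by ext; rfl
  map_comp f g := by ext; rfl

instance : (smoothFunctor.{u, v, w} k G).Additive where
  map_add := by intros; ext; rfl

/-! `SmRep k G` is abelian: smooth representations are stable under subobjects, quotients and
finite products. -/

instance : (IsSmooth.{u, v, w} k G).IsClosedUnderSubobjects where
  prop_of_mono {X Y} f _ hY := by
    rw [isSmooth_iff] at hY ⊢
    intro x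
    obtain ⟨K, hK, h⟩ := hY (f.hom x)
    refine ⟨K, hK, fun g hg => (Rep.mono_iff_injective f).1 inferInstance ?_⟩
    exact (Rep.hom_comm_apply f g x).trans (h g hg)

instance : (IsSmooth.{u, v, w} k G).IsClosedUnderQuotients where
  prop_of_epi {X Y} f _ hX := by
    rw [isSmooth_iff] at hX ⊢
    intro y
    obtain ⟨x, rfl⟩ := (Rep.epi_iff_surjective f).1 inferInstance y
    obtain ⟨K, hK, h⟩ := hX x
    refine ⟨K, hK, fun g hg => ?_⟩
    exact (Rep.hom_comm_apply f g x).symm.trans (congrArg f.hom (h g hg))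

instance : (IsSmooth.{u, v, w} k G).ContainsZero where
  exists_zero := ⟨Rep.trivial k G PUnit, (Rep.isZero_iff k G _).2 (inferInstanceAs (Subsingleton PUnit)), by
    rw [isSmooth_iff]
    exact fun x => ⟨⊤, by simp, fun g _ => rfl⟩⟩

instance : (IsSmooth.{u, v, w} k G).IsClosedUnderFiniteProducts := by
  have : (IsSmooth.{u, v, w} k G).IsClosedUnderBinaryProducts := by
    refine ⟨?_⟩
    rintro X ⟨P⟩
    let a : X ⟶ P.diag.obj ⟨.left⟩ := P.π.app ⟨.left⟩
    let b : X ⟶ P.diag.obj ⟨.right⟩ := P.π.app ⟨.right⟩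
    have hA := (isSmooth_iff _).1 (P.prop_diag_obj ⟨.left⟩)
    have hB := (isSmooth_iff _).1 (P.prop_diag_obj ⟨.right⟩)
    let f : X ⟶ P.diag.obj ⟨.left⟩ ⊞ P.diag.obj ⟨.right⟩ := biprod.lift a b
    have : Mono f := ⟨fun s t hst => P.isLimit.hom_ext <| by
      rintro ⟨_ | _⟩
      · simpa [f, a] using hst =≫ biprod.fst
      · simpa [f, b] using hst =≫ biprod.snd⟩
    have hf := (Rep.mono_iff_injective f).1 inferInstance
    rw [isSmooth_iff]
    intro x
    obtain ⟨K, hK, hx⟩ := hA (a.hom x)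
    obtain ⟨L, hL, hy⟩ := hB (b.hom x)
    refine ⟨K ⊓ L, by rw [Subgroup.coe_inf]; exact hK.inter hL, fun g hg => hf ?_⟩
    have key : ∀ z : X, f.hom z = (biprod.inl : _ ⟶ P.diag.obj ⟨.left⟩ ⊞ P.diag.obj ⟨.right⟩).hom
        (a.hom z) + (biprod.inr : _ ⟶ P.diag.obj ⟨.left⟩ ⊞ P.diag.obj ⟨.right⟩).hom
        (b.hom z) := by
      intro z
      have : f = a ≫ biprod.inl + b ≫ biprod.inr := biprod.lift_eq
      rw [this]
      rfl
    rw [key, key, Rep.hom_comm_apply a g x, Rep.hom_comm_apply b g x, hx g hg.1, hy g hg.2]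
  exact ObjectProperty.IsClosedUnderFiniteProducts.mk'

end SmoothRep

/-! Let V → I⁰ → I¹ → I² begin an injective resolution. A smooth cocycle in I¹ is the image of some
y in I⁰, and the claim is that every such y is already smooth (`mem_smoothPart_of_map_mem`). For g
in the open stabilizer of the image of y, the difference g y - y comes from V and so has open
stabilizer. It remains to deduce that y has open stabilizer.

The characteristic ℓ of k enters through single elements. If x fixes x y - y, then xⁿ y = y + n (x y
- y), so x^ℓ fixes y. A commutation argument produces this situation on a whole compact procyclic
group, so every γ in a compact subgroup has a positive power whose closed cyclic group fixes y
(`exists_pow_topologicalClosure_le_vectorStabilizer`).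

The analytic structure makes finitely many elements enough. In a chart at 1, multiplication is
addition up to a contracting error, so ordered products of procyclic groups in the d coordinate
directions fill a neighbourhood of 1, even after passing to n-th powers
(`IsAlmostAdditiveOn.exists_list_forall_isOpen`). The stabilizer of y contains such a product, hence
is open. -/

/-! ### Stabilizers of vectors and the identity (x - 1)² y = 0 -/

namespace Representation

variable {k : Type*} [Field k] {G : Type*} [Group G] {W : Type*} [AddCommGroup W] [Module k W]

/-- The stabilizer of a vector in a representation. -/
def vectorStabilizer (ρ : Representation k G W) (y : W) : Subgroup G where
  carrier := {g | ρ g y = y}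
  mul_mem' {a b} ha hb := by
    change ρ (a * b) y = y
    rw [map_mul, Module.End.mul_apply, show ρ b y = y from hb, show ρ a y = y from ha]
  one_mem' := by simp
  inv_mem' {a} ha := by
    change ρ a⁻¹ y = y
    conv_lhs => rw [← show ρ a y = y from ha]
    simp

lemma mem_vectorStabilizer {ρ : Representation k G W} {y : W} {g : G} :
    g ∈ ρ.vectorStabilizer y ↔ ρ g y = y := Iff.rfl

/-- For commuting `a` and `b`, the element `a` fixes `b y - y` if `b` fixes `a y - y`. -/
lemma mem_vectorStabilizer_sub_comm (ρ : Representation k G W) {a b : G} (hab : Commute a b)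
    {y : W} (h : b ∈ ρ.vectorStabilizer (ρ a y - y)) : a ∈ ρ.vectorStabilizer (ρ b y - y) := by
  -- Both conditions say (a - 1)(b - 1) y = 0, which is symmetric for commuting elements.
  rw [mem_vectorStabilizer, map_sub] at *
  rw [← Module.End.mul_apply, ← map_mul] at *
  rw [hab.eq]
  rw [sub_eq_iff_eq_add] at h ⊢
  rw [h]
  abel

/-- Since (x - 1)² y = 0, the binomial expansion of xⁿ y stops after the linear term. For n the
characteristic of k, that term vanishes too. -/
lemma pow_apply_eq_add_nsmul (ρ : Representation k G W) {x : G} {y : W}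
    (h : x ∈ ρ.vectorStabilizer (ρ x y - y)) (n : ℕ) :
    ρ (x ^ n) y = y + n • (ρ x y - y) := by
  induction n with
  | zero => simp
  | succ n ih =>
    have hn := mem_vectorStabilizer.1 ((ρ.vectorStabilizer (ρ x y - y)).pow_mem h n)
    rw [map_sub, ih] at hn
    rw [pow_succ, map_mul, Module.End.mul_apply, succ_nsmul]
    rw [sub_eq_iff_eq_add.1 hn, add_comm, add_assoc]

end Representation

/-! ### Procyclic subgroups fixing a vector -/

section Stabilizer

variable {G : Type*} [Group G] [TopologicalSpace G] [IsTopologicalGroup G]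

/-- In a compact subgroup some positive power of every element lies in a given open subgroup. -/
lemma Subgroup.exists_pow_mem_of_isCompact_of_isOpen {K U : Subgroup G}
    (hK : IsCompact (K : Set G)) (hU : IsOpen (U : Set G)) {g : G} (hg : g ∈ K) :
    ∃ n, 0 < n ∧ g ^ n ∈ U := by
  have : CompactSpace K := isCompact_iff_compactSpace.1 hK
  have : Finite (K ⧸ U.subgroupOf K) :=
    Subgroup.quotient_finite_of_isOpen _ (hU.preimage continuous_subtype_val)
  obtain ⟨n, hn, -, h⟩ := Subgroup.exists_pow_mem_of_relIndex_ne_zero (H := U) (K := K)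
    Subgroup.index_ne_zero_of_finite hg
  exact ⟨n, hn, h.1⟩

variable [T2Space G]

/-- If `g y - y` is a smooth vector for all `g` in an open subgroup, then every element `γ` of a
compact subgroup has a positive power such that the closure of the group it generates fixes `y`. -/
theorem Representation.exists_pow_topologicalClosure_le_vectorStabilizer
    {k : Type*} [Field k] (hk : 0 < ringChar k) {W : Type*} [AddCommGroup W] [Module k W]
    (ρ : Representation k G W) {N : Subgroup G} (hN : IsOpen (N : Set G)) {y : W}
    (hsm : ∀ g ∈ N, IsOpen (ρ.vectorStabilizer (ρ g y - y) : Set G))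
    {K : Subgroup G} (hK : IsCompact (K : Set G)) {γ : G} (hγ : γ ∈ K) :
    ∃ n, 0 < n ∧ (Subgroup.zpowers (γ ^ n)).topologicalClosure ≤ ρ.vectorStabilizer y := by
  obtain ⟨i, hi, hiN⟩ := Subgroup.exists_pow_mem_of_isCompact_of_isOpen hK hN hγ
  obtain ⟨j, hj, hjU⟩ := Subgroup.exists_pow_mem_of_isCompact_of_isOpen hK (hsm _ hiN)
    (K.pow_mem hγ i)
  -- By `hjU` the power (γ^i)^j fixes γ^i y - y. Exchanging the two, γ^i fixes the difference for
  -- (γ^i)^j, and hence so does its j-th power.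
  have hself : (γ ^ i) ^ j ∈ ρ.vectorStabilizer (ρ ((γ ^ i) ^ j) y - y) :=
    Subgroup.pow_mem _
      (ρ.mem_vectorStabilizer_sub_comm ((Commute.refl (γ ^ i)).pow_right j) hjU) j
  set δ := (γ ^ i) ^ j with hδ
  have hδN : δ ∈ N := N.pow_mem hiN j
  have hδK : δ ∈ K := K.pow_mem (K.pow_mem hγ i) j
  set C := (Subgroup.zpowers δ).topologicalClosure with hC
  have hCN : C ≤ N := Subgroup.topologicalClosure_minimal _
    (Subgroup.zpowers_le.2 hδN) (N.isClosed_of_isOpen hN)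
  have hCK : C ≤ K := Subgroup.topologicalClosure_minimal _ (Subgroup.zpowers_le.2 hδK) hK.isClosed
  have hCcpt : IsCompact (C : Set G) :=
    hK.of_isClosed_subset (Subgroup.isClosed_topologicalClosure _) hCK
  have hle : ∀ {z : W}, IsOpen (ρ.vectorStabilizer z : Set G) → δ ∈ ρ.vectorStabilizer z →
      C ≤ ρ.vectorStabilizer z := fun hz hmem => Subgroup.topologicalClosure_minimal _
    (Subgroup.zpowers_le.2 hmem) (Subgroup.isClosed_of_isOpen _ hz)
  -- Open stabilizers are closed, so what δ fixes among the differences is fixed by C. This is used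
  -- twice: C fixes δ y - y, so by exchange δ fixes x y - y, so C fixes x y - y.
  have hfix : ∀ x ∈ C, x ∈ ρ.vectorStabilizer (ρ x y - y) := by
    intro x hx
    have hcomm : Commute δ x := by
      have : C ≤ Subgroup.centralizer {δ} := Subgroup.topologicalClosure_minimal _
        (Subgroup.zpowers_le.2 (Subgroup.mem_centralizer_singleton_iff.2 rfl))
        (Set.isClosed_centralizer _)
      exact (Subgroup.mem_centralizer_singleton_iff.1 (this hx)).symm
    exact hle (hsm x (hCN hx))
      (ρ.mem_vectorStabilizer_sub_comm hcomm (hle (hsm δ hδN) hself hx)) hx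
  refine ⟨i * j * ringChar k, by positivity, ?_⟩
  have himage : (C.carrier).image (fun x => x ^ ringChar k) ⊆ ρ.vectorStabilizer y := by
    rintro _ ⟨x, hx, rfl⟩
    have := ρ.pow_apply_eq_add_nsmul (hfix x hx) (ringChar k)
    rw [← Nat.cast_smul_eq_nsmul k, ringChar.Nat.cast_ringChar, zero_smul, add_zero] at this
    exact this
  -- The stabilizer of y is not known to be closed. The set of `ringChar k`-th powers of C is, being
  -- compact, and it contains the powers of δ ^ `ringChar k`.
  refine fun g hg => himage ((closure_minimal ?_
    (hCcpt.image (continuous_pow (ringChar k))).isClosed) hg)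
  rintro _ ⟨n, rfl⟩
  refine ⟨δ ^ n, subset_closure ⟨n, rfl⟩, ?_⟩
  simp only [hδ, ← zpow_natCast, ← zpow_mul]
  push_cast
  ring_nf

end Stabilizer

/-! ### Almost additive coordinates and ordered products of procyclic groups -/

section Coordinates

variable {p : ℕ} [Fact p.Prime] {d : ℕ} {G : Type*} [Group G]

/-- A map `φ` to `ℚ_p ^ d` is almost additive on the subgroup `K` if `(g, h) ↦ φ (g * h)` differs on
`K` from `φ g + φ h` by a function of `(φ g, φ h)` with Lipschitz constant `p⁻²`. -/
structure IsAlmostAdditiveOn (φ : G → Fin d → ℚ_[p]) (K : Subgroup G) : Prop where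
  map_one : φ 1 = 0
  norm_map_mul_sub_le : ∀ g ∈ K, ∀ h ∈ K, ∀ g' ∈ K, ∀ h' ∈ K,
    ‖φ (g * h) - φ (g' * h') - ((φ g - φ g') + (φ h - φ h'))‖ ≤
      (p : ℝ)⁻¹ ^ 2 * max ‖φ g - φ g'‖ ‖φ h - φ h'‖

lemma norm_add_le_of_le_of_le {E : Type*} [SeminormedAddGroup E] [IsUltrametricDist E] {a b : E}
    {M : ℝ} (ha : ‖a‖ ≤ M) (hb : ‖b‖ ≤ M) : ‖a + b‖ ≤ M :=
  (IsUltrametricDist.norm_add_le_max a b).trans (max_le ha hb)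

lemma Nat.Prime.inv_cast_pos (p : ℕ) [Fact p.Prime] : 0 < (p : ℝ)⁻¹ :=
  inv_pos.2 (Nat.cast_pos.2 (Fact.out : p.Prime).pos)

lemma Nat.Prime.inv_cast_lt_one (p : ℕ) [Fact p.Prime] : (p : ℝ)⁻¹ < 1 :=
  inv_lt_one_of_one_lt₀ (Nat.one_lt_cast.2 (Fact.out : p.Prime).one_lt)

namespace IsAlmostAdditiveOn

open Nat.Prime

variable {φ : G → Fin d → ℚ_[p]} {K : Subgroup G}

/-- A crude bound that ignores the size of n. At n = p it still beats ‖p φ(g)‖ by a factor p⁻¹,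
which is why the Lipschitz constant is p⁻² and not p⁻¹. -/
lemma norm_map_pow_sub_le_of_mem (h : IsAlmostAdditiveOn φ K) {g : G} (hg : g ∈ K)
    (n : ℕ) :
    ‖φ (g ^ n) - (n : ℚ_[p]) • φ g‖ ≤ (p : ℝ)⁻¹ ^ 2 * ‖φ g‖ := by
  have h0 := inv_cast_pos p
  have h1 := inv_cast_lt_one p
  induction n with
  | zero => simp [h.map_one]; positivity
  | succ n ih =>
    have hn : ‖φ (g ^ n)‖ ≤ ‖φ g‖ := by
      rw [← sub_add_cancel (φ (g ^ n)) ((n : ℚ_[p]) • φ g)]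
      refine norm_add_le_of_le_of_le (ih.trans ?_) ?_
      · exact mul_le_of_le_one_left (norm_nonneg _) (pow_le_one₀ h0.le h1.le)
      · rw [norm_smul]
        exact mul_le_of_le_one_left (norm_nonneg _)
          (by simpa using Padic.norm_int_le_one (p := p) n)
    have := h.norm_map_mul_sub_le _ (K.pow_mem hg n) _ hg _ K.one_mem _ K.one_mem
    simp only [mul_one, h.map_one, sub_zero, max_eq_right hn] at this
    have e : φ (g ^ (n + 1)) - ((n + 1 : ℕ) : ℚ_[p]) • φ g =
        (φ (g ^ n * g) - (φ (g ^ n) + φ g)) + (φ (g ^ n) - (n : ℚ_[p]) • φ g) := by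
      rw [pow_succ]; push_cast; module
    rw [e]
    exact norm_add_le_of_le_of_le this ih

/-- In almost additive coordinates the `n`-th power map is close to multiplication by `n`. -/
lemma norm_map_pow_sub_le (h : IsAlmostAdditiveOn φ K) {g : G} (hg : g ∈ K)
    (n : ℕ) :
    ‖φ (g ^ n) - (n : ℚ_[p]) • φ g‖ ≤ (p : ℝ)⁻¹ * (‖(n : ℚ_[p])‖ * ‖φ g‖) := by
  have h0 := inv_cast_pos p
  have h1 := inv_cast_lt_one p
  induction n using Nat.strong_induction_on generalizing g with
  | _ n ih =>
  -- Factors p are split off one at a time by passing from g to g ^ p; for n prime to p, ‖n‖ = 1 and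
  -- the crude bound suffices.
  by_cases hpn : p ∣ n
  · obtain ⟨m, rfl⟩ := hpn
    rcases Nat.eq_zero_or_pos m with rfl | hm
    · simp [h.map_one]
    have hlt : m < p * m := lt_mul_of_one_lt_left hm (Fact.out : p.Prime).one_lt
    have hp : ‖φ (g ^ p) - (p : ℚ_[p]) • φ g‖ ≤ (p : ℝ)⁻¹ * ((p : ℝ)⁻¹ * ‖φ g‖) := by
      have := h.norm_map_pow_sub_le_of_mem hg p
      rwa [pow_two, mul_assoc] at this
    have hp' : ‖φ (g ^ p)‖ ≤ (p : ℝ)⁻¹ * ‖φ g‖ := by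
      rw [← sub_add_cancel (φ (g ^ p)) ((p : ℚ_[p]) • φ g)]
      refine norm_add_le_of_le_of_le (hp.trans ?_) ?_
      · exact mul_le_of_le_one_left (by positivity) h1.le
      · rw [norm_smul, Padic.norm_p]
    have e : φ (g ^ (p * m)) - ((p * m : ℕ) : ℚ_[p]) • φ g =
        (φ ((g ^ p) ^ m) - (m : ℚ_[p]) • φ (g ^ p)) +
          (m : ℚ_[p]) • (φ (g ^ p) - (p : ℚ_[p]) • φ g) := by
      rw [pow_mul]; push_cast; module
    rw [e, Nat.cast_mul, norm_mul, Padic.norm_p]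
    refine norm_add_le_of_le_of_le ((ih m hlt (K.pow_mem hg p)).trans ?_) ?_
    · calc (p : ℝ)⁻¹ * (‖(m : ℚ_[p])‖ * ‖φ (g ^ p)‖)
          ≤ (p : ℝ)⁻¹ * (‖(m : ℚ_[p])‖ * ((p : ℝ)⁻¹ * ‖φ g‖)) := by gcongr
        _ = _ := by ring
    · rw [norm_smul]
      calc ‖(m : ℚ_[p])‖ * ‖φ (g ^ p) - (p : ℚ_[p]) • φ g‖
          ≤ ‖(m : ℚ_[p])‖ * ((p : ℝ)⁻¹ * ((p : ℝ)⁻¹ * ‖φ g‖)) := by gcongr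
        _ = _ := by ring
  · have : ‖(n : ℚ_[p])‖ = 1 := Padic.norm_natCast_eq_one_iff.2
      ((Nat.Prime.coprime_iff_not_dvd Fact.out).2 hpn)
    rw [this, one_mul]
    refine (h.norm_map_pow_sub_le_of_mem hg n).trans ?_
    gcongr
    exact pow_le_of_le_one h0.le h1.le two_ne_zero

/-- Successive approximation needs control of increments of the exponent, relative to the size of
the increment b alone. -/
lemma norm_map_pow_add_sub_le (h : IsAlmostAdditiveOn φ K) {g : G} (hg : g ∈ K)
    (a b : ℕ) :
    ‖φ (g ^ (a + b)) - φ (g ^ a) - (b : ℚ_[p]) • φ g‖ ≤ (p : ℝ)⁻¹ * (‖(b : ℚ_[p])‖ * ‖φ g‖) := by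
  have h0 := inv_cast_pos p
  have h1 := inv_cast_lt_one p
  have hb := h.norm_map_pow_sub_le hg b
  have hb' : ‖φ (g ^ b)‖ ≤ ‖(b : ℚ_[p])‖ * ‖φ g‖ := by
    rw [← sub_add_cancel (φ (g ^ b)) ((b : ℚ_[p]) • φ g)]
    refine norm_add_le_of_le_of_le (hb.trans ?_) (norm_smul _ _).le
    exact mul_le_of_le_one_left (by positivity) h1.le
  have := h.norm_map_mul_sub_le _ (K.pow_mem hg a) _ (K.pow_mem hg b) _ (K.pow_mem hg a)
    _ K.one_mem
  simp only [mul_one, h.map_one, sub_zero, sub_self, norm_zero, zero_add,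
    max_eq_right (norm_nonneg _)] at this
  have e : φ (g ^ (a + b)) - φ (g ^ a) - (b : ℚ_[p]) • φ g =
      (φ (g ^ a * g ^ b) - φ (g ^ a) - φ (g ^ b)) + (φ (g ^ b) - (b : ℚ_[p]) • φ g) := by
    rw [pow_add]; abel
  rw [e]
  refine norm_add_le_of_le_of_le (this.trans ?_) hb
  exact mul_le_mul (pow_le_of_le_one h0.le h1.le two_ne_zero) hb' (norm_nonneg _) h0.le

/-- In almost additive coordinates an ordered product of powers is close to a linear map in the
exponents. -/
lemma norm_map_prod_pow_add_sub_le (h : IsAlmostAdditiveOn φ K) {ι : Type*} {g : ι → G}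
    (hg : ∀ i, g i ∈ K) (a b : ι → ℕ)
    {M : ℝ} (hM₀ : 0 ≤ M) (hM : ∀ i, ‖(b i : ℚ_[p])‖ * ‖φ (g i)‖ ≤ M) (l : List ι) :
    ‖φ (l.map fun i => g i ^ (a i + b i)).prod - φ (l.map fun i => g i ^ a i).prod -
      (l.map fun i => (b i : ℚ_[p]) • φ (g i)).sum‖ ≤ (p : ℝ)⁻¹ * M := by
  have h0 := inv_cast_pos p
  have h1 := inv_cast_lt_one p
  have hM1 : (p : ℝ)⁻¹ * M ≤ M := mul_le_of_le_one_left hM₀ h1.le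
  have hmem : ∀ (c : ι → ℕ) (l : List ι), (l.map fun i => g i ^ c i).prod ∈ K := by
    intro c l
    refine K.list_prod_mem fun x hx => ?_
    obtain ⟨i, -, rfl⟩ := List.mem_map.1 hx
    exact K.pow_mem (hg i) _
  have hsum : ∀ l : List ι, ‖(l.map fun i => (b i : ℚ_[p]) • φ (g i)).sum‖ ≤ M := by
    intro l
    induction l with
    | nil => simpa
    | cons i l ih =>
      rw [List.map_cons, List.sum_cons]
      exact norm_add_le_of_le_of_le ((norm_smul _ _).le.trans (hM i)) ih
  induction l with
  | nil => simp; positivity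
  | cons i l ih =>
    simp only [List.map_cons, List.prod_cons, List.sum_cons]
    set P := (l.map fun i => g i ^ a i).prod
    set Q := (l.map fun i => g i ^ (a i + b i)).prod
    set S := (l.map fun i => (b i : ℚ_[p]) • φ (g i)).sum
    have hA : ‖φ (g i ^ (a i + b i)) - φ (g i ^ a i) - (b i : ℚ_[p]) • φ (g i)‖ ≤ (p : ℝ)⁻¹ * M :=
      (h.norm_map_pow_add_sub_le (hg i) _ _).trans (mul_le_mul_of_nonneg_left (hM i) h0.le)
    have hA' : ‖φ (g i ^ (a i + b i)) - φ (g i ^ a i)‖ ≤ M := by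
      rw [← sub_add_cancel (φ (g i ^ (a i + b i)) - φ (g i ^ a i)) ((b i : ℚ_[p]) • φ (g i))]
      exact norm_add_le_of_le_of_le (hA.trans hM1) ((norm_smul _ _).le.trans (hM i))
    have hB' : ‖φ Q - φ P‖ ≤ M := by
      rw [← sub_add_cancel (φ Q - φ P) S]
      exact norm_add_le_of_le_of_le (ih.trans hM1) (hsum l)
    have key := h.norm_map_mul_sub_le _ (K.pow_mem (hg i) (a i + b i)) Q (hmem _ l) _
      (K.pow_mem (hg i) (a i)) P (hmem _ l)
    have e : φ (g i ^ (a i + b i) * Q) - φ (g i ^ a i * P) - ((b i : ℚ_[p]) • φ (g i) + S) =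
        (φ (g i ^ (a i + b i) * Q) - φ (g i ^ a i * P) -
          ((φ (g i ^ (a i + b i)) - φ (g i ^ a i)) + (φ Q - φ P))) +
        ((φ (g i ^ (a i + b i)) - φ (g i ^ a i) - (b i : ℚ_[p]) • φ (g i)) +
          (φ Q - φ P - S)) := by abel
    rw [e]
    refine norm_add_le_of_le_of_le (key.trans ?_) (norm_add_le_of_le_of_le hA ih)
    exact mul_le_mul (pow_le_of_le_one h0.le h1.le two_ne_zero) (max_le hA' hB')
      (le_max_of_le_left (norm_nonneg _)) h0.le

end IsAlmostAdditiveOn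

/-- A map `ℕ ^ d → ℚ_p ^ d` that is close to multiplication by `c` has dense image in the ball
of radius `‖c‖`. -/
lemma mem_closure_range_of_norm_sub_le {c : ℚ_[p]} (hc : c ≠ 0) {Ψ : (Fin d → ℕ) → Fin d → ℚ_[p]}
    (h0 : Ψ 0 = 0) (hΨ : ∀ (a b : Fin d → ℕ) (M : ℝ), 0 ≤ M → (∀ i, ‖(b i : ℚ_[p])‖ ≤ M) →
      ‖Ψ (a + b) - Ψ a - c • (fun i => (b i : ℚ_[p]))‖ ≤ (p : ℝ)⁻¹ * (‖c‖ * M))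
    {y : Fin d → ℚ_[p]} (hy : ‖y‖ ≤ ‖c‖) : y ∈ closure (Set.range Ψ) := by
  have hp0 := Nat.Prime.inv_cast_pos p
  have hp1 := Nat.Prime.inv_cast_lt_one p
  have hc0 : 0 < ‖c‖ := norm_pos_iff.2 hc
  have key : ∀ n : ℕ, ∃ a, ‖y - Ψ a‖ ≤ ‖c‖ * (p : ℝ)⁻¹ ^ n := by
    intro n
    induction n with
    | zero => exact ⟨0, by simpa [h0] using hy⟩
    | succ n ih =>
      obtain ⟨a, ha⟩ := ih
      -- Natural numbers b congruent modulo p ^ (n + 1) to the coordinates of the rescaled residue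
      -- serve as correction; each step gains a factor p⁻¹.
      set e := c⁻¹ • (y - Ψ a) with he
      have hen : ‖e‖ ≤ (p : ℝ)⁻¹ ^ n := by
        rw [he, norm_smul, norm_inv]
        rwa [inv_mul_le_iff₀ hc0]
      have happrox : ∀ i, ∃ b : ℕ, ‖e i - b‖ ≤ (p : ℝ)⁻¹ ^ (n + 1) := by
        intro i
        let z : ℤ_[p] := ⟨e i, (norm_le_pi_norm e i).trans (hen.trans (pow_le_one₀ hp0.le hp1.le))⟩
        refine ⟨z.appr (n + 1), ?_⟩
        have := (PadicInt.norm_le_pow_iff_mem_span_pow _ _).2 (PadicInt.appr_spec (n + 1) z)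
        rw [zpow_neg, zpow_natCast, ← inv_pow] at this
        exact this
      choose b hb using happrox
      have hbn : ∀ i, ‖(b i : ℚ_[p])‖ ≤ (p : ℝ)⁻¹ ^ n := by
        intro i
        have : (b i : ℚ_[p]) = e i + -(e i - b i) := by ring
        rw [this]
        refine norm_add_le_of_le_of_le ((norm_le_pi_norm e i).trans hen) ?_
        rw [norm_neg]
        exact (hb i).trans (pow_le_pow_of_le_one hp0.le hp1.le n.le_succ)
      refine ⟨a + b, ?_⟩
      have hsplit : y - Ψ (a + b) = c • (e - fun i => (b i : ℚ_[p])) +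
          -(Ψ (a + b) - Ψ a - c • (fun i => (b i : ℚ_[p]))) := by
        rw [smul_sub, he, smul_inv_smul₀ hc]; abel
      rw [hsplit]
      refine norm_add_le_of_le_of_le ?_ ?_
      · rw [norm_smul]
        exact mul_le_mul_of_nonneg_left ((pi_norm_le_iff_of_nonneg (by positivity)).2 hb) hc0.le
      · rw [norm_neg]
        refine (hΨ a b _ (by positivity) hbn).trans (le_of_eq ?_)
        ring
  rw [Metric.mem_closure_range_iff]
  intro ε hε
  have ht : Filter.Tendsto (fun n : ℕ => ‖c‖ * (p : ℝ)⁻¹ ^ n) Filter.atTop (nhds (‖c‖ * 0)) :=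
    (tendsto_pow_atTop_nhds_zero_of_lt_one hp0.le hp1).const_mul _
  rw [mul_zero] at ht
  obtain ⟨n, hn⟩ := (ht.eventually (gt_mem_nhds hε)).exists
  obtain ⟨a, ha⟩ := key n
  exact ⟨a, by rw [dist_eq_norm]; exact ha.trans_lt hn⟩

variable [TopologicalSpace G] [IsTopologicalGroup G]

/-- Ordered products of powers of finitely many elements lie in a compact set contained in any
subgroup that contains the closures of the cyclic groups they generate. -/
lemma exists_isCompact_forall_prod_pow_mem [T2Space G] {ι : Type*} {K H : Subgroup G}
    (hK : IsCompact (K : Set G)) {g : ι → G} (hg : ∀ i, g i ∈ K)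
    (hH : ∀ i, (Subgroup.zpowers (g i)).topologicalClosure ≤ H) (l : List ι) :
    ∃ P : Set G, IsCompact P ∧ P ⊆ K ∧ P ⊆ H ∧
      ∀ a : ι → ℕ, (l.map fun i => g i ^ a i).prod ∈ P := by
  induction l with
  | nil => exact ⟨{1}, isCompact_singleton, by simp, by simp, by simp⟩
  | cons i l ih =>
    obtain ⟨P, hP, hPK, hPH, hmem⟩ := ih
    set C := (Subgroup.zpowers (g i)).topologicalClosure
    have hCK : C ≤ K := Subgroup.topologicalClosure_minimal _ (Subgroup.zpowers_le.2 (hg i))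
      hK.isClosed
    have hC : IsCompact (C : Set G) :=
      hK.of_isClosed_subset (Subgroup.isClosed_topologicalClosure _) hCK
    refine ⟨(fun x : G × G => x.1 * x.2) '' ((C : Set G) ×ˢ P),
      (hC.prod hP).image continuous_mul, ?_, ?_, fun a => ?_⟩
    · rintro _ ⟨⟨x, y⟩, ⟨hx, hy⟩, rfl⟩
      exact K.mul_mem (hCK hx) (hPK hy)
    · rintro _ ⟨⟨x, y⟩, ⟨hx, hy⟩, rfl⟩
      exact H.mul_mem (hH i hx) (hPH hy)
    · rw [List.map_cons, List.prod_cons]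
      exact ⟨(_, _), ⟨subset_closure (Subgroup.npow_mem_zpowers _ _), hmem a⟩, rfl⟩

/-- A compact open subgroup with almost additive coordinates is locally generated by finitely
many procyclic subgroups, even after replacing these by open subgroups of the same shape. -/
theorem IsAlmostAdditiveOn.exists_list_forall_isOpen [T2Space G] {φ : G → Fin d → ℚ_[p]}
    {K : Subgroup G} (h : IsAlmostAdditiveOn φ K) (hK : IsCompact (K : Set G)) (hK' : IsOpen (K : Set G))
    (hcont : ContinuousOn φ K) (hinj : Set.InjOn φ K) {r : ℝ} (hr : 0 < r)
    (hsurj : ∀ x, ‖x‖ ≤ r → ∃ g ∈ K, φ g = x) :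
    ∃ l : List G, (∀ g ∈ l, g ∈ K) ∧ ∀ (n : ℕ) (H : Subgroup G), 0 < n →
      (∀ g ∈ l, (Subgroup.zpowers (g ^ n)).topologicalClosure ≤ H) → IsOpen (H : Set G) := by
  obtain ⟨s, hs⟩ := exists_pow_lt_of_lt_one hr (Nat.Prime.inv_cast_lt_one p)
  have hnorm : ‖(p : ℚ_[p]) ^ s‖ = (p : ℝ)⁻¹ ^ s := by rw [norm_pow, Padic.norm_p]
  have hp0 : (p : ℚ_[p]) ≠ 0 := Nat.cast_ne_zero.2 (Fact.out : p.Prime).ne_zero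
  -- The factor p ^ s brings the basis vectors into the ball of radius r. The n-th powers then have
  -- coordinates close to c times the basis vectors, with c = n p ^ s.
  have hex : ∀ i : Fin d, ∃ g ∈ K, φ g = Pi.single i ((p : ℚ_[p]) ^ s) := fun i =>
    hsurj _ (by rw [Pi.norm_single, hnorm]; exact hs.le)
  choose g hgK hg using hex
  refine ⟨List.ofFn g, fun x hx => ?_, fun n H hn hH => ?_⟩
  · obtain ⟨i, rfl⟩ := (List.mem_ofFn' _ _).1 hx
    exact hgK i
  obtain ⟨P, hP, hPK, hPH, hmem⟩ := exists_isCompact_forall_prod_pow_mem hK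
    (fun i => K.pow_mem (hgK i) n) (fun i => hH (g i) ((List.mem_ofFn' _ _).2 ⟨i, rfl⟩))
    (List.finRange d)
  set c : ℚ_[p] := n * (p : ℚ_[p]) ^ s with hc
  have hc0 : c ≠ 0 := mul_ne_zero (Nat.cast_ne_zero.2 hn.ne') (pow_ne_zero _ hp0)
  set Ψ : (Fin d → ℕ) → Fin d → ℚ_[p] :=
    fun a => φ ((List.finRange d).map fun i => (g i ^ n) ^ a i).prod with hΨ
  have hsub : Set.range Ψ ⊆ φ '' P := by
    rintro _ ⟨a, rfl⟩
    exact ⟨_, hmem a, rfl⟩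
  -- Compactness of P turns the dense image into a full ball; H itself need not be closed.
  have hclosed : IsClosed (φ '' P) := (hP.image_of_continuousOn (hcont.mono hPK)).isClosed
  have hball : ∀ x ∈ K, ‖φ x‖ ≤ ‖c‖ → x ∈ H := by
    intro x hx hxc
    have : φ x ∈ closure (Set.range Ψ) := by
      refine mem_closure_range_of_norm_sub_le hc0 ?_ (fun a b M hM hb => ?_) hxc
      · simp [hΨ, h.map_one]
      · have := h.norm_map_prod_pow_add_sub_le hgK (fun i => n * a i) (fun i => n * b i)
          (M := ‖c‖ * M) (by positivity) (fun i => ?_) (List.finRange d)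
        · convert this using 2
          simp only [hΨ, ← pow_mul, Pi.add_apply, mul_add]
          congr 1
          ext j
          rw [← List.ofFn_eq_map, List.sum_ofFn]
          simp only [hg, Finset.sum_apply, Pi.smul_apply, smul_eq_mul, Pi.single_apply]
          simp [hc]
          ring
        · rw [hg, Pi.norm_single, hc, Nat.cast_mul, norm_mul, norm_mul]
          have := hb i
          calc ‖(n : ℚ_[p])‖ * ‖(b i : ℚ_[p])‖ * ‖(p : ℚ_[p]) ^ s‖
              ≤ ‖(n : ℚ_[p])‖ * M * ‖(p : ℚ_[p]) ^ s‖ := by gcongr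
            _ = _ := by ring
    obtain ⟨q, hq, hqx⟩ := closure_minimal hsub hclosed this
    rw [← hinj (hPK hq) hx hqx]
    exact hPH hq
  refine Subgroup.isOpen_of_mem_nhds H (g := 1) ?_
  have hK1 : (K : Set G) ∈ nhds (1 : G) := hK'.mem_nhds K.one_mem
  have hcont1 : ContinuousAt (fun x => ‖φ x‖) 1 := (hcont.continuousAt hK1).norm
  have : ∀ᶠ x in nhds (1 : G), ‖φ x‖ < ‖c‖ :=
    hcont1.eventually (gt_mem_nhds (by simpa [h.map_one] using hc0))
  filter_upwards [hK1, this] with x hx hxc using hball x hx hxc.le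

end Coordinates

/-! ### Almost additive coordinates from an analytic chart -/

section Chart

variable {p : ℕ} [Fact p.Prime] {d : ℕ} {G : Type*} [Group G] [TopologicalSpace G]
  [ChartedSpace (Fin d → ℚ_[p]) G]

/-- Multiplication of an analytic group, in a chart around the identity, is strictly differentiable
with derivative the addition. -/
lemma hasStrictFDerivAt_chartAt_mul [LieGroup 𝓘(ℚ_[p], Fin d → ℚ_[p]) ω G] :
    HasStrictFDerivAt (fun z : (Fin d → ℚ_[p]) × (Fin d → ℚ_[p]) =>
        chartAt (Fin d → ℚ_[p]) (1 : G) ((chartAt (Fin d → ℚ_[p]) (1 : G)).symm z.1 *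
          (chartAt (Fin d → ℚ_[p]) (1 : G)).symm z.2))
      (ContinuousLinearMap.fst ℚ_[p] _ _ + ContinuousLinearMap.snd ℚ_[p] _ _)
      (chartAt (Fin d → ℚ_[p]) (1 : G) 1, chartAt (Fin d → ℚ_[p]) (1 : G) 1) := by
  set e := chartAt (Fin d → ℚ_[p]) (1 : G) with he
  have h1 : (1 : G) ∈ e.source := mem_chart_source _ _
  have hc : e 1 ∈ e.target := e.map_source h1
  have hs : e.symm (e 1) = 1 := e.left_inv h1
  have hsymm : ContMDiffAt 𝓘(ℚ_[p], Fin d → ℚ_[p]) 𝓘(ℚ_[p], Fin d → ℚ_[p]) ω e.symm (e 1) :=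
    (contMDiffOn_chart_symm (x := (1 : G))).contMDiffAt (e.open_target.mem_nhds hc)
  have hmul : ContMDiffAt 𝓘(ℚ_[p], (Fin d → ℚ_[p]) × (Fin d → ℚ_[p]))
      𝓘(ℚ_[p], Fin d → ℚ_[p]) ω
      (fun z : (Fin d → ℚ_[p]) × (Fin d → ℚ_[p]) => e.symm z.1 * e.symm z.2) (e 1, e 1) :=
    ContMDiffAt.mul
      (ContMDiffAt.comp (e 1, e 1) (g := e.symm) hsymm contDiff_fst.contDiffAt.contMDiffAt)
      (ContMDiffAt.comp (e 1, e 1) (g := e.symm) hsymm contDiff_snd.contDiffAt.contMDiffAt)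
  have hchart : ContMDiffAt 𝓘(ℚ_[p], Fin d → ℚ_[p]) 𝓘(ℚ_[p], Fin d → ℚ_[p]) ω e
      (e.symm (e 1) * e.symm (e 1)) := by
    rw [hs, one_mul]
    exact (contMDiffOn_chart (x := (1 : G))).contMDiffAt (e.open_source.mem_nhds h1)
  have hF := (ContMDiffAt.comp (e 1, e 1) (g := e)
    (f := fun z : (Fin d → ℚ_[p]) × (Fin d → ℚ_[p]) => e.symm z.1 * e.symm z.2)
    hchart hmul).contDiffAt.analyticAt.hasStrictFDerivAt
  set L := fderiv ℚ_[p] (e ∘ fun z : (Fin d → ℚ_[p]) × (Fin d → ℚ_[p]) =>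
    e.symm z.1 * e.symm z.2) (e 1, e 1)
  -- On each axis one factor is 1, so the map is the identity near `e 1`.
  have hL : L = ContinuousLinearMap.fst ℚ_[p] _ _ + ContinuousLinearMap.snd ℚ_[p] _ _ := by
    have hl : L.comp (ContinuousLinearMap.inl ℚ_[p] _ _) = ContinuousLinearMap.id ℚ_[p] _ := by
      refine (HasFDerivAt.comp (e 1) (f := fun x => (x, e 1)) hF.hasFDerivAt
        (hasFDerivAt_prodMk_left (e 1) (e 1))).unique
        ((hasFDerivAt_id (e 1)).congr_of_eventuallyEq ?_)
      filter_upwards [e.open_target.mem_nhds hc] with x hx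
      simp [hs, e.right_inv hx]
    have hr : L.comp (ContinuousLinearMap.inr ℚ_[p] _ _) = ContinuousLinearMap.id ℚ_[p] _ := by
      refine (HasFDerivAt.comp (e 1) (f := fun x => (e 1, x)) hF.hasFDerivAt
        (hasFDerivAt_prodMk_right (e 1) (e 1))).unique
        ((hasFDerivAt_id (e 1)).congr_of_eventuallyEq ?_)
      filter_upwards [e.open_target.mem_nhds hc] with x hx
      simp [hs, e.right_inv hx]
    refine ContinuousLinearMap.ext fun z => ?_
    have h₁ := congrArg (fun f => f z.1) hl
    have h₂ := congrArg (fun f => f z.2) hr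
    simp only [ContinuousLinearMap.comp_apply, ContinuousLinearMap.inl_apply,
      ContinuousLinearMap.inr_apply, ContinuousLinearMap.id_apply] at h₁ h₂
    calc L z = L ((z.1, 0) + (0, z.2)) := by simp
      _ = z.1 + z.2 := by rw [map_add, h₁, h₂]
  rw [hL] at hF
  exact hF

/-- A `p`-adic analytic group has a compact open subgroup with almost additive coordinates. -/
theorem exists_isAlmostAdditiveOn [IsTopologicalGroup G]
    [LieGroup 𝓘(ℚ_[p], Fin d → ℚ_[p]) ω G] :
    ∃ (φ : G → Fin d → ℚ_[p]) (K : Subgroup G) (r : ℝ), IsAlmostAdditiveOn φ K ∧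
      IsCompact (K : Set G) ∧ IsOpen (K : Set G) ∧ ContinuousOn φ K ∧ Set.InjOn φ K ∧ 0 < r ∧
      ∀ x, ‖x‖ ≤ r → ∃ g ∈ K, φ g = x := by
  have hp0 := Nat.Prime.inv_cast_pos p
  have hp1 := Nat.Prime.inv_cast_lt_one p
  have hF := hasStrictFDerivAt_chartAt_mul (p := p) (d := d) (G := G)
  set e := chartAt (Fin d → ℚ_[p]) (1 : G) with he
  have h1 : (1 : G) ∈ e.source := mem_chart_source _ _
  have hc : e 1 ∈ e.target := e.map_source h1
  have hs : e.symm (e 1) = 1 := e.left_inv h1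
  obtain ⟨S, hS, happ⟩ := hF.approximates_deriv_on_nhds (c := (p : NNReal)⁻¹ ^ 2)
    (Or.inr (by have := (Fact.out : p.Prime).pos; positivity))
  have hsymm : ContinuousAt e.symm (e 1) := e.continuousAt_symm hc
  obtain ⟨r₀, hr₀, hr₀S⟩ := Metric.nhds_basis_closedBall.mem_iff.1 hS
  have hmulc : ContinuousAt (fun z : (Fin d → ℚ_[p]) × (Fin d → ℚ_[p]) =>
      e.symm z.1 * e.symm z.2) (e 1, e 1) :=
    (ContinuousAt.comp (f := Prod.fst) (x := (e 1, e 1)) hsymm continuousAt_fst).mul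
      (ContinuousAt.comp (f := Prod.snd) (x := (e 1, e 1)) hsymm continuousAt_snd)
  have hmul : ∀ᶠ z in nhds (e 1, e 1), e.symm z.1 * e.symm z.2 ∈ e.source :=
    hmulc.eventually_mem (e.open_source.mem_nhds (by simpa [hs] using h1))
  have hinvc : ContinuousAt (fun x => (e.symm x)⁻¹) (e 1) := hsymm.inv
  have hinv : ∀ᶠ x in nhds (e 1), (e.symm x)⁻¹ ∈ e.source :=
    hinvc.eventually_mem (e.open_source.mem_nhds (by simpa [hs] using h1))
  have hinv' : ∀ᶠ x in nhds (e 1), e (e.symm x)⁻¹ ∈ Metric.closedBall (e 1) r₀ := by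
    have : ContinuousAt (fun x => e (e.symm x)⁻¹) (e 1) :=
      ContinuousAt.comp (f := fun x => (e.symm x)⁻¹)
        (by simpa [hs] using e.continuousAt h1) hinvc
    exact this.eventually_mem (by simpa [hs] using Metric.closedBall_mem_nhds (e 1) hr₀)
  obtain ⟨r₁, hr₁, hr₁mul⟩ := Metric.nhds_basis_closedBall.mem_iff.1 hmul
  -- This radius keeps inverses inside the ball of radius r₀, where the estimate `hest₁` applies.
  obtain ⟨r₂, hr₂, hr₂inv⟩ := Metric.nhds_basis_closedBall.mem_iff.1
    ((hinv.and hinv').and (e.open_target.mem_nhds hc))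
  set r := min r₀ (min r₁ r₂) with hr
  have hrpos : 0 < r := lt_min hr₀ (lt_min hr₁ hr₂)
  have hrr₀ : r ≤ r₀ := min_le_left _ _
  have hrr₁ : r ≤ r₁ := (min_le_right _ _).trans (min_le_left _ _)
  have hrr₂ : r ≤ r₂ := (min_le_right _ _).trans (min_le_right _ _)
  have hest : ∀ g ∈ e.source, ∀ h ∈ e.source, ∀ g' ∈ e.source, ∀ h' ∈ e.source,
      ‖e g - e 1‖ ≤ r₀ → ‖e h - e 1‖ ≤ r₀ → ‖e g' - e 1‖ ≤ r₀ → ‖e h' - e 1‖ ≤ r₀ →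
      ‖e (g * h) - e (g' * h') - ((e g - e g') + (e h - e h'))‖ ≤
        (p : ℝ)⁻¹ ^ 2 * max ‖e g - e g'‖ ‖e h - e h'‖ := by
    intro g hg h hh g' hg' h' hh' ng nh ng' nh'
    have := happ (e g, e h) (hr₀S ?_) (e g', e h') (hr₀S ?_)
    · simpa [e.left_inv hg, e.left_inv hh, e.left_inv hg', e.left_inv hh', Prod.norm_def]
        using this
    · rw [mem_closedBall_iff_norm, Prod.mk_sub_mk, Prod.norm_mk]
      exact max_le ng nh
    · rw [mem_closedBall_iff_norm, Prod.mk_sub_mk, Prod.norm_mk]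
      exact max_le ng' nh'
  have hest₁ : ∀ g ∈ e.source, ∀ h ∈ e.source, ‖e g - e 1‖ ≤ r₀ → ‖e h - e 1‖ ≤ r₀ →
      ‖e (g * h) - e 1 - ((e g - e 1) + (e h - e 1))‖ ≤
        (p : ℝ)⁻¹ ^ 2 * max ‖e g - e 1‖ ‖e h - e 1‖ := by
    intro g hg h hh ng nh
    simpa using hest g hg h hh 1 h1 1 h1 ng nh (by simpa using hr₀.le) (by simpa using hr₀.le)
  have hball : Metric.closedBall (e 1) r ⊆ e.target := fun x hx =>
    (hr₂inv (Metric.closedBall_subset_closedBall hrr₂ hx)).2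
  let K : Subgroup G :=
    { carrier := {g | g ∈ e.source ∧ ‖e g - e 1‖ ≤ r}
      one_mem' := ⟨h1, by simpa using hrpos.le⟩
      mul_mem' := by
        rintro g h ⟨hg, ng⟩ ⟨hh, nh⟩
        refine ⟨?_, ?_⟩
        · have : (e g, e h) ∈ Metric.closedBall (e 1, e 1) r₁ := by
            rw [mem_closedBall_iff_norm, Prod.mk_sub_mk, Prod.norm_mk]
            exact max_le (ng.trans hrr₁) (nh.trans hrr₁)
          simpa [e.left_inv hg, e.left_inv hh] using hr₁mul this
        · rw [← sub_add_cancel (e (g * h) - e 1) ((e g - e 1) + (e h - e 1))]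
          refine norm_add_le_of_le_of_le
            ((hest₁ g hg h hh (ng.trans hrr₀) (nh.trans hrr₀)).trans ?_) (norm_add_le_of_le_of_le ng nh)
          exact (mul_le_of_le_one_left (le_max_of_le_left (norm_nonneg _))
            (pow_le_one₀ hp0.le hp1.le)).trans (max_le ng nh)
      inv_mem' := by
        rintro g ⟨hg, ng⟩
        have hmem : e g ∈ Metric.closedBall (e 1) r₂ := by
          rw [mem_closedBall_iff_norm]
          exact ng.trans hrr₂
        have hg' : g⁻¹ ∈ e.source := by simpa [e.left_inv hg] using (hr₂inv hmem).1.1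
        have ng' : ‖e g⁻¹ - e 1‖ ≤ r₀ := by
          have := (hr₂inv hmem).1.2
          rwa [mem_closedBall_iff_norm, e.left_inv hg] at this
        refine ⟨hg', ?_⟩
        -- If g⁻¹ were farther from 1 than g, the sum of their coordinates would have the norm of
        -- that of g⁻¹, while the estimate for g g⁻¹ = 1 bounds it by p⁻² times that norm.
        by_contra! hlt
        have hlt' : ‖e g - e 1‖ < ‖e g⁻¹ - e 1‖ := ng.trans_lt hlt
        have := hest₁ g hg _ hg' (ng.trans hrr₀) ng'
        rw [mul_inv_cancel, sub_self, zero_sub, norm_neg, max_eq_right hlt'.le,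
          IsUltrametricDist.norm_add_eq_max_of_norm_ne_norm hlt'.ne, max_eq_right hlt'.le] at this
        refine this.not_gt (mul_lt_of_lt_one_left (hrpos.trans hlt) ?_)
        exact pow_lt_one₀ hp0.le hp1 two_ne_zero }
  have hKset : (K : Set G) = e.source ∩ e ⁻¹' Metric.closedBall (e 1) r := by
    ext g
    rw [Set.mem_inter_iff, Set.mem_preimage, mem_closedBall_iff_norm]
    rfl
  have hKimage : (K : Set G) = e.symm '' Metric.closedBall (e 1) r := by
    rw [hKset, e.symm_image_eq_source_inter_preimage hball]
  refine ⟨fun g => e g - e 1, K, r, ⟨sub_self _, ?_⟩, ?_, ?_, ?_, ?_, hrpos, ?_⟩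
  · intro g hg h hh g' hg' h' hh'
    simpa using hest g hg.1 h hh.1 g' hg'.1 h' hh'.1 (hg.2.trans hrr₀) (hh.2.trans hrr₀)
      (hg'.2.trans hrr₀) (hh'.2.trans hrr₀)
  · rw [hKimage]
    exact (isCompact_closedBall _ _).image_of_continuousOn (e.continuousOn_symm.mono hball)
  · refine Subgroup.isOpen_of_mem_nhds K (g := 1) ?_
    rw [hKset]
    exact Filter.inter_mem (e.open_source.mem_nhds h1)
      ((e.continuousAt h1).preimage_mem_nhds (Metric.closedBall_mem_nhds _ hrpos))
  · exact (e.continuousOn.mono fun g hg => hg.1).sub continuousOn_const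
  · exact fun g hg h hh hgh => e.injOn hg.1 hh.1 (sub_left_injective hgh)
  · intro x hx
    have hx' : x + e 1 ∈ e.target := hball (by simpa [mem_closedBall_iff_norm] using hx)
    refine ⟨e.symm (x + e 1), ⟨e.map_target hx', ?_⟩, ?_⟩
    · simpa [e.right_inv hx'] using hx
    · simp [e.right_inv hx']

end Chart

/-! ### Open stabilizers in p-adic analytic groups -/

/-- A `p`-adic analytic group is Hausdorff and has a compact open subgroup `K` with finitely many
elements such that a subgroup is open as soon as it contains, for some `n > 0`, the closures of the
cyclic groups generated by their `n`-th powers. -/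
theorem IsPadicAnalyticGroup.exists_isCompact_isOpen_list {p : ℕ} [Fact p.Prime] {G : Type*}
    [Group G] [TopologicalSpace G] [IsTopologicalGroup G] (hG : IsPadicAnalyticGroup p G) :
    T2Space G ∧ ∃ (K : Subgroup G) (l : List G),
      IsCompact (K : Set G) ∧ IsOpen (K : Set G) ∧ (∀ g ∈ l, g ∈ K) ∧
      ∀ (n : ℕ) (H : Subgroup G), 0 < n →
        (∀ g ∈ l, (Subgroup.zpowers (g ^ n)).topologicalClosure ≤ H) → IsOpen (H : Set G) := by
  obtain ⟨d, _, _⟩ := hG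
  have : T1Space G := ChartedSpace.t1Space (Fin d → ℚ_[p]) G
  have hT2 : T2Space G := inferInstance
  obtain ⟨φ, K, r, h, hK, hK', hcont, hinj, hr, hsurj⟩ :=
    exists_isAlmostAdditiveOn (p := p) (d := d) (G := G)
  obtain ⟨l, hl, hl'⟩ := h.exists_list_forall_isOpen hK hK' hcont hinj hr hsurj
  exact ⟨hT2, K, l, hK, hK', hl, hl'⟩

/-- A vector `y` has open stabilizer if all `g y - y`, for `g` in an open subgroup, do. -/
lemma Representation.isOpen_vectorStabilizer_of_isPadicAnalyticGroup {p : ℕ} [Fact p.Prime]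
    {G : Type*} [Group G] [TopologicalSpace G] [IsTopologicalGroup G]
    (hG : IsPadicAnalyticGroup p G) {k : Type*} [Field k] (hk : 0 < ringChar k)
    {W : Type*} [AddCommGroup W] [Module k W]
    (ρ : Representation k G W) {N : Subgroup G} (hN : IsOpen (N : Set G)) {y : W}
    (hsm : ∀ g ∈ N, IsOpen (ρ.vectorStabilizer (ρ g y - y) : Set G)) :
    IsOpen (ρ.vectorStabilizer y : Set G) := by
  obtain ⟨_, K, l, hK, -, hl, h⟩ := hG.exists_isCompact_isOpen_list
  have key : ∀ l : List G, (∀ g ∈ l, g ∈ K) → ∃ n, 0 < n ∧ ∀ g ∈ l,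
      (Subgroup.zpowers (g ^ n)).topologicalClosure ≤ ρ.vectorStabilizer y := by
    intro l
    induction l with
    | nil => exact fun _ => ⟨1, one_pos, by simp⟩
    | cons a l ih =>
      intro hl
      obtain ⟨m, hm, hm'⟩ := ih fun g hg => hl g (List.mem_cons_of_mem _ hg)
      obtain ⟨n, hn, hn'⟩ := ρ.exists_pow_topologicalClosure_le_vectorStabilizer hk hN hsm hK
        (hl a List.mem_cons_self)
      -- Multiplying the exponent only shrinks the closed cyclic groups, so the product serves all
      -- elements at once.
      refine ⟨m * n, by positivity, fun g hg => ?_⟩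
      rcases List.mem_cons.1 hg with rfl | hg
      · refine (Subgroup.topologicalClosure_mono (Subgroup.zpowers_le.2 ?_)).trans hn'
        rw [mul_comm, pow_mul]
        exact Subgroup.pow_mem _ (Subgroup.mem_zpowers _) _
      · refine (Subgroup.topologicalClosure_mono (Subgroup.zpowers_le.2 ?_)).trans (hm' g hg)
        rw [pow_mul]
        exact Subgroup.pow_mem _ (Subgroup.mem_zpowers _) _
  obtain ⟨n, hn, hn'⟩ := key l hl
  exact h n _ hn hn'

/-! ### Smooth vectors and the first derived functor -/

namespace SmoothRep

variable {k : Type u} [Field k] {G : Type v} [Group G] [TopologicalSpace G] [IsTopologicalGroup G]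

lemma isOpen_vectorStabilizer_of_isSmooth {V : Rep.{w} k G} (hV : IsSmooth k G V) (x : V) :
    IsOpen (V.ρ.vectorStabilizer x : Set G) := by
  obtain ⟨K, hK, h⟩ := (isSmooth_iff V).1 hV x
  exact Subgroup.isOpen_mono (H₁ := K) h hK

lemma isOpen_vectorStabilizer_of_mem_smoothPart {V : Rep.{w} k G} {x : V}
    (hx : x ∈ smoothPart V) : IsOpen (V.ρ.vectorStabilizer x : Set G) := by
  obtain ⟨K, hK, h⟩ := exists_isOpen_of_mem_smoothPart V hx
  exact Subgroup.isOpen_mono (H₁ := K) h hK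

lemma mem_smoothPart_of_isOpen_vectorStabilizer
    (hG : ∃ K : Subgroup G, IsCompact (K : Set G) ∧ IsOpen (K : Set G)) {V : Rep.{w} k G} {x : V}
    (hx : IsOpen (V.ρ.vectorStabilizer x : Set G)) : x ∈ smoothPart V := by
  obtain ⟨K, hK, hK'⟩ := hG
  refine (mem_smoothPart_iff ⟨K, hK, hK'⟩).2 ⟨K ⊓ V.ρ.vectorStabilizer x, ?_, ?_, ?_⟩
  · rw [Subgroup.coe_inf]
    exact hK.inter_right (Subgroup.isClosed_of_isOpen _ hx)
  · rw [Subgroup.coe_inf]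
    exact hK'.inter hx
  · exact fun g hg => hg.2

variable (k G) in
instance preservesHomology_ι : (IsSmooth.{u, v, w} k G).ι.PreservesHomology where
  preservesKernels _ _ f := ObjectProperty.preservesKernels_ι _ f
  preservesCokernels _ _ f := ObjectProperty.preservesCokernels_ι _ f

lemma _root_.Rep.exact_iff_function_exact {G : Type v} [Group G] (S : ShortComplex (Rep.{w} k G)) :
    S.Exact ↔ Function.Exact S.f.hom S.g.hom := by
  rw [← S.exact_map_iff_of_faithful (forget₂ (Rep.{w} k G) (ModuleCat k)),
    ShortComplex.ShortExact.moduleCat_exact_iff_function_exact]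
  rfl

lemma exact_iff_function_exact (S : ShortComplex (SmRep.{u, v, w} k G)) :
    S.Exact ↔ Function.Exact S.f.hom.hom S.g.hom.hom := by
  rw [← S.exact_map_iff_of_faithful (IsSmooth.{u, v, w} k G).ι, Rep.exact_iff_function_exact]
  rfl

/-- Under a map with smooth kernel every preimage of a smooth vector is smooth. -/
lemma mem_smoothPart_of_map_mem {p : ℕ} [Fact p.Prime] (hG : IsPadicAnalyticGroup p G)
    (hk : 0 < ringChar k) {V I J : Rep.{w} k G} (hV : IsSmooth k G V) (i : V ⟶ I) (f : I ⟶ J)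
    (hif : Function.Exact i.hom f.hom) {y : I} (hy : f.hom y ∈ smoothPart J) :
    y ∈ smoothPart I := by
  obtain ⟨-, K, -, hK, hK', -⟩ := hG.exists_isCompact_isOpen_list
  refine mem_smoothPart_of_isOpen_vectorStabilizer ⟨K, hK, hK'⟩
    (I.ρ.isOpen_vectorStabilizer_of_isPadicAnalyticGroup hG hk
      (isOpen_vectorStabilizer_of_mem_smoothPart hy) fun g hg => ?_)
  -- Here g runs through the stabilizer of f y, so f kills g y - y.
  obtain ⟨x, hx⟩ := (hif (I.ρ g y - y)).1 (by
    rw [map_sub, Rep.hom_comm_apply f g y, sub_eq_zero]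
    exact hg)
  refine Subgroup.isOpen_mono (H₁ := V.ρ.vectorStabilizer x) (fun a ha => ?_)
    (isOpen_vectorStabilizer_of_isSmooth hV x)
  rw [Representation.mem_vectorStabilizer] at ha ⊢
  rw [← hx, ← Rep.hom_comm_apply i a x, ha]

end SmoothRep

theorem theorem4p1 (p : ℕ) [Fact p.Prime] (G : Type v) [Group G] [TopologicalSpace G]
    [IsTopologicalGroup G] (hG : IsPadicAnalyticGroup p G)
    (k : Type u) [Field k] (hk : 0 < ringChar k)
    (V : SmoothRep.SmRep.{u, v, max u v w} k G) :
    IsZero (((SmoothRep.smoothFunctor.{u, v, max u v w} k G).rightDerived 1).obj V.obj) := by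
  let I := injectiveResolution V.obj
  refine IsZero.of_iso ?_ (I.isoRightDerivedObj (SmoothRep.smoothFunctor k G) 1)
  refine (HomologicalComplex.exactAt_iff_isZero_homology _ _).1 ?_
  rw [HomologicalComplex.exactAt_iff' _ 0 1 2 (by simp) (by simp),
    SmoothRep.exact_iff_function_exact]
  have h0 : Function.Exact (I.ι.f 0).hom (I.cocomplex.d 0 1).hom :=
    (Rep.exact_iff_function_exact _).1 I.exact₀
  have h1 : Function.Exact (I.cocomplex.d 0 1).hom (I.cocomplex.d 1 2).hom :=
    (Rep.exact_iff_function_exact _).1 (I.exact_succ 0)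
  rintro ⟨x, hx⟩
  constructor
  · intro h
    obtain ⟨y, rfl⟩ := (h1 x).1 (congrArg Subtype.val h)
    -- The preimage y given by exactness is smooth as it stands; no correction by an element of V is
    -- needed.
    exact ⟨⟨y, SmoothRep.mem_smoothPart_of_map_mem hG hk V.property _ _ h0 hx⟩, rfl⟩
  · rintro ⟨⟨y, hy⟩, h⟩
    exact Subtype.ext ((h1 x).2 ⟨y, congrArg Subtype.val h⟩)
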